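/- Let $\mathcal B$ be a separable complex Banach space with a continuous dense embedding $\mathcal B\subset\mathcal H_2$ in a Hilbert space $\mathcal H_2$, and let $0<p<\infty$. Let $\mathbb S_p[\mathcal H_2]$ be the set of bounded operators $T$ on $\mathcal H_2$ with $\operatorname{Tr}[T^*T]^{p/2}<\infty$, put $\|T\|_p^{\mathcal H_2}=\{\operatorname{Tr}[T^*T]^{p/2}\}^{1/p}$, and let $\mathbb S_p[\mathcal B]=\mathbb S_p[\mathcal H_2]\cap L[\mathcal B]$ be the set of bounded operators $A$ on $\mathcal B$ whose (unique) bounded extension $\bar A$ to $\mathcal H_2$ exists and lies in $\mathbb S_p[\mathcal H_2]$. For such an $A$, let $A^*$ be the restriction of the Hilbert space adjoint $\bar A^*$ to $\mathcal B$, i.e. the operator with domain $\{u\in\mathcal B:\bar A^*u\in\mathcal B\}$ and $A^*u=\bar A^*u$. For $u\in\mathcal B$, a Steadman duality map for $u$ is a functional $f_u^s\in\mathcal B'$ with $f_u^s(x)=\dfrac{\|u\|_{\mathcal B}^2}{\|u\|_{\mathcal H_2}^2}(x,u)_{\mathcal H_2}$ for $x$ in the line spanned by $u$ (read as $0$ if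 $u=0$) and $|f_u^s(x)|\le\|u\|_{\mathcal B}\|x\|_{\mathcal B}$ for all $x\in\mathcal B$. Let $A\in\mathbb S_p[\mathcal B]$, and let $\bar A=\bar U|\bar A|$, $|\bar A|=[\bar A^*\bar A]^{1/2}$, be the polar decomposition of $\bar A$. Suppose that $\bar A=\sum_n\mu_n(\,\cdot\,,\bar\varphi_n)_2\,\bar U\bar\varphi_n$ (strongly), where $\{\bar\varphi_n\}$ is an $\mathcal H_2$-orthonormal family of eigenvectors, $|\bar A|\bar\varphi_n=\mu_n\bar\varphi_n$ with $\mu_n\ge 0$, and every $\bar\varphi_n$ lies in $\mathcal B$. Put $\varphi_n=\bar\varphi_n/\|\bar\varphi_n\|_{\mathcal B}$, and let $f_n^s$ be any Steadman duality map for $\varphi_n$. Then every $A\varphi_n$ lies in the domain of $A^*$, the numbers $\langle A^*A\varphi_n,f_n^s\rangle$ are real and nonnegative, the series below converges, and $$\|A\|_p^{\mathcal B}:=\Big\{\sum_n\langle A^*A\varphi_n,f_n^s\rangle^{p/2}\Big\}^{1/p}=\|\bar A\|_p^{\mathcal H_2}.$$ -/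

import Mathlib

noncomputable section

namespace SchattenBanach

/-- A continuous dense embedding of a complex Banach space `B` in a Hilbert space `H`. -/
structure DenseEmbedding (B H : Type*) [NormedAddCommGroup B] [NormedSpace ℂ B]
    [NormedAddCommGroup H] [InnerProductSpace ℂ H] where
  /-- the embedding, a bounded linear map -/
  toCLM : B →L[ℂ] H
  injective : Function.Injective toCLM
  dense : DenseRange toCLM

section Hilbert

variable {H : Type*} [NormedAddCommGroup H] [InnerProductSpace ℂ H] [CompleteSpace H]

/-- The trace, in `[0, ∞]`, of a positive operator `S`, computed in an orthonormal basis of `H`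
(for positive operators its value is the same in every orthonormal basis). -/
def posTrace (S : H →L[ℂ] H) : ENNReal :=
  ∑' e : (exists_hilbertBasis ℂ H).choose, ENNReal.ofReal (inner ℂ (e : H) (S (e : H))).re

/-- `Tr [T* T] ^ (p / 2)`, in `[0, ∞]`, with the power given by the continuous functional
calculus. -/
def schattenTrace (p : ℝ) (T : H →L[ℂ] H) : ENNReal :=
  posTrace ((ContinuousLinearMap.adjoint T * T) ^ (p / 2))

/-- The Schatten class `S_p[H]`: the operators with `Tr [T* T] ^ (p / 2) < ∞`. -/
def schattenClass (p : ℝ) (H : Type*) [NormedAddCommGroup H] [InnerProductSpace ℂ H]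
    [CompleteSpace H] : Set (H →L[ℂ] H) :=
  {T | schattenTrace p T < ⊤}

/-- The Schatten norm `(Tr [T* T] ^ (p / 2)) ^ (1 / p)` of an operator in `S_p[H]`. -/
def schattenNorm (p : ℝ) (T : H →L[ℂ] H) : ℝ :=
  (schattenTrace p T).toReal ^ (1 / p)

/-- The modulus `|T| = [T* T] ^ (1 / 2)`. -/
def modulus (T : H →L[ℂ] H) : H →L[ℂ] H :=
  CFC.sqrt (ContinuousLinearMap.adjoint T * T)

/-- `U` is the partial isometry of the polar decomposition `T = U |T|`. -/
structure IsPolarFactor (U T : H →L[ℂ] H) : Prop where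
  eq_mul : T = U * modulus T
  norm_map : ∀ x ∈ (U : H →ₗ[ℂ] H).kerᗮ, ‖U x‖ = ‖x‖
  ker_eq : (U : H →ₗ[ℂ] H).ker = (T : H →ₗ[ℂ] H).ker

/-- The singular value expansion `T = ∑ μ_n ( · , ψ_n) U ψ_n`: the `ψ_n` are orthonormal
eigenvectors of `|T|` for the eigenvalues `μ_n ≥ 0`, and `T = U |T|` is the polar decomposition. -/
structure IsSingularSystem {ι : Type*} (T U : H →L[ℂ] H) (μ : ι → ℝ) (ψ : ι → H) : Prop where
  polar : IsPolarFactor U T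
  orthonormal : Orthonormal ℂ ψ
  nonneg : ∀ n, 0 ≤ μ n
  eigen : ∀ n, modulus T (ψ n) = (μ n : ℂ) • ψ n
  expansion : ∀ x, HasSum (fun n => ((μ n : ℂ) * inner ℂ (ψ n) x) • U (ψ n)) (T x)

end Hilbert

section Banach

variable {B H : Type*} [NormedAddCommGroup B] [NormedSpace ℂ B]
  [NormedAddCommGroup H] [InnerProductSpace ℂ H]

/-- `T`, an operator on `H`, extends the operator `A` on `B`. -/
def IsExtension (j : DenseEmbedding B H) (A : B →L[ℂ] B) (T : H →L[ℂ] H) : Prop :=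
  ∀ u, T (j.toCLM u) = j.toCLM (A u)

/-- `f` is a Steadman duality map for `u`, associated with `H`: a Hahn-Banach extension, with
`|f x| ≤ ‖u‖ ‖x‖` on `B`, of the functional `x ↦ (‖u‖_B ^ 2 / ‖u‖_H ^ 2) (x, u)_H` on the line
spanned by `u`. -/
structure IsSteadmanMap (j : DenseEmbedding B H) (u : B) (f : B →L[ℂ] ℂ) : Prop where
  on_span : ∀ x ∈ Submodule.span ℂ {u},
    f x = ((‖u‖ ^ 2 / ‖j.toCLM u‖ ^ 2 : ℝ) : ℂ) * inner ℂ (j.toCLM u) (j.toCLM x)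
  bound : ∀ x, ‖f x‖ ≤ ‖u‖ * ‖x‖

/-- The restriction to `B` of an operator `S` on `H`: the linear operator on `B` with domain
`{u ∈ B | S u ∈ B}` which sends `u` to `S u`. -/
def restrictToB (j : DenseEmbedding B H) (S : H →L[ℂ] H) : B →ₗ.[ℂ] B where
  domain := (j.toCLM : B →ₗ[ℂ] H).range.comap ((S ∘L j.toCLM : B →L[ℂ] H) : B →ₗ[ℂ] H)
  toFun :=
    (LinearEquiv.ofInjective (j.toCLM : B →ₗ[ℂ] H) j.injective).symm.toLinearMap ∘ₗ
      (((S ∘L j.toCLM : B →L[ℂ] H) : B →ₗ[ℂ] H).restrict fun _ hu => hu)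

variable [CompleteSpace H]

/-- The adjoint `A*` on `B` of an operator `A` on `B` with extension `T` to `H`: the restriction
to `B` of the Hilbert space adjoint `T*`. -/
def banachAdjoint (j : DenseEmbedding B H) (T : H →L[ℂ] H) : B →ₗ.[ℂ] B :=
  restrictToB j (ContinuousLinearMap.adjoint T)

/-- The Schatten class `S_p[B] = S_p[H] ∩ L[B]`: the bounded operators on `B` that extend to
an operator in `S_p[H]`. -/
def banachSchattenClass (j : DenseEmbedding B H) (p : ℝ) : Set (B →L[ℂ] B) :=
  {A | ∃ T ∈ schattenClass p H, IsExtension j A T}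

/-- The pairing `⟨A* A u, f⟩`, for `u` in the domain of `A* A`; `T` is the extension of `A`. -/
def starPairing (j : DenseEmbedding B H) (A : B →L[ℂ] B) (T : H →L[ℂ] H) (u : B)
    (hu : A u ∈ (banachAdjoint j T).domain) (f : B →L[ℂ] ℂ) : ℂ :=
  f (banachAdjoint j T ⟨A u, hu⟩)

/-- `(∑ ⟨A* A φ_n, f_n⟩ ^ (p / 2)) ^ (1 / p)`, for pairings that are nonnegative reals. -/
def banachSchattenNorm {ι : Type*} (j : DenseEmbedding B H) (p : ℝ) (A : B →L[ℂ] B)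
    (T : H →L[ℂ] H) (φ : ι → B) (hφ : ∀ n, A (φ n) ∈ (banachAdjoint j T).domain)
    (f : ι → B →L[ℂ] ℂ) : ℝ :=
  (∑' n, (starPairing j A T (φ n) (hφ n) (f n)).re ^ (p / 2)) ^ (1 / p)

end Banach

end SchattenBanach

end

/-!
The `ψ n` are eigenvectors of `T† T` with eigenvalues `μ n ^ 2`, and `T` vanishes on their
orthogonal complement. A continuous function of an operator acts on an eigenvector through the
eigenvalue, so, completing `ψ` to a Hilbert basis, the trace of `(T† T) ^ (p / 2)` is
`∑ (μ n ^ 2) ^ (p / 2)`. On the Banach side, `A* A φ n = μ n ^ 2 • φ n` already holds in `B`, and a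
Steadman map sends a vector to the square of its norm, so the pairing of `A* A φ n` with `f n` is
`μ n ^ 2`, whichever Steadman map is chosen.
-/

namespace SchattenBanach

open ContinuousLinearMap
open scoped InnerProduct

section Trace

variable {𝕜 E F κ κ' : Type*} [RCLike 𝕜]
  [NormedAddCommGroup E] [InnerProductSpace 𝕜 E] [NormedAddCommGroup F] [InnerProductSpace 𝕜 F]

theorem tsum_enorm_inner_sq (b : HilbertBasis κ 𝕜 E) (x : E) :
    ∑' i, ‖inner 𝕜 (b i) x‖ₑ ^ 2 = ‖x‖ₑ ^ 2 := by
  have hsum : HasSum (fun i => ‖inner 𝕜 (b i) x‖ ^ 2) (‖x‖ ^ 2) := by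
    simpa [b.repr_apply_apply] using lp.hasSum_norm (p := 2) (by norm_num) (b.repr x)
  simp_rw [← ofReal_norm, ← ENNReal.ofReal_pow (norm_nonneg _)]
  rw [← ENNReal.ofReal_tsum_of_nonneg (fun _ => by positivity) hsum.summable, hsum.tsum_eq]

theorem tsum_enorm_apply_sq_eq_tsum_enorm_adjoint_apply_sq [CompleteSpace E] [CompleteSpace F]
    (b : HilbertBasis κ 𝕜 E) (d : HilbertBasis κ' 𝕜 F) (R : E →L[𝕜] F) :
    ∑' i, ‖R (b i)‖ₑ ^ 2 = ∑' k, ‖(R†) (d k)‖ₑ ^ 2 := by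
  calc ∑' i, ‖R (b i)‖ₑ ^ 2 = ∑' i, ∑' k, ‖inner 𝕜 (d k) (R (b i))‖ₑ ^ 2 := by
        simp_rw [tsum_enorm_inner_sq d]
    _ = ∑' k, ∑' i, ‖inner 𝕜 (b i) ((R†) (d k))‖ₑ ^ 2 := by
        rw [ENNReal.tsum_comm]
        simp_rw [adjoint_inner_right, ← ofReal_norm, norm_inner_symm]
    _ = ∑' k, ‖(R†) (d k)‖ₑ ^ 2 := by simp_rw [tsum_enorm_inner_sq b]

variable {H : Type*} [NormedAddCommGroup H] [InnerProductSpace ℂ H] [CompleteSpace H]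

theorem ofReal_re_inner_adjoint_mul_self (R : H →L[ℂ] H) (x : H) :
    ENNReal.ofReal (inner ℂ x ((R† * R) x)).re = ‖R x‖ₑ ^ 2 := by
  rw [mul_apply_eq_comp, adjoint_inner_right, ← ofReal_norm,
    ← ENNReal.ofReal_pow (norm_nonneg _)]
  exact congrArg ENNReal.ofReal (inner_self_eq_norm_sq (𝕜 := ℂ) (R x))

theorem posTrace_eq_tsum {S : H →L[ℂ] H} (hS : 0 ≤ S) (b : HilbertBasis κ ℂ H) :
    posTrace S = ∑' i, ENNReal.ofReal (inner ℂ (b i) (S (b i))).re := by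
  obtain ⟨R, rfl⟩ := CStarAlgebra.nonneg_iff_eq_star_mul_self.mp hS
  obtain ⟨d, hd⟩ := (exists_hilbertBasis ℂ H).choose_spec
  simp only [posTrace, star_eq_adjoint, ofReal_re_inner_adjoint_mul_self]
  calc ∑' e : (exists_hilbertBasis ℂ H).choose, ‖R e‖ₑ ^ 2
      = ∑' e, ‖R (d e)‖ₑ ^ 2 := by rw [hd]
    _ = ∑' e, ‖(R†) (d e)‖ₑ ^ 2 := tsum_enorm_apply_sq_eq_tsum_enorm_adjoint_apply_sq d d R
    _ = ∑' i, ‖R (b i)‖ₑ ^ 2 := (tsum_enorm_apply_sq_eq_tsum_enorm_adjoint_apply_sq b d R).symm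

theorem posTrace_eq_tsum_eigenvalues {ι : Type*} {S : H →L[ℂ] H} (hS : 0 ≤ S) {ψ : ι → H}
    (hψ : Orthonormal ℂ ψ) {c : ι → ℝ} (heig : ∀ n, S (ψ n) = (c n : ℂ) • ψ n)
    (hker : ∀ x, (∀ n, inner ℂ (ψ n) x = 0) → S x = 0) :
    posTrace S = ∑' n, ENNReal.ofReal (c n) := by
  obtain ⟨w, b, hw, hb⟩ := hψ.toSubtypeRange.exists_hilbertBasis_extension
  let e : ι → w := fun n => ⟨ψ n, hw ⟨n, rfl⟩⟩
  have he : Function.Injective e := fun _ _ h =>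
    hψ.linearIndependent.injective (congrArg Subtype.val h)
  have hbe : ∀ n, b (e n) = ψ n := fun n => by rw [hb]
  have hsupp : (Function.support fun i => ENNReal.ofReal (inner ℂ (b i) (S (b i))).re) ⊆
      Set.range e := fun i hi => by
    by_contra hrange
    refine hi ?_
    have hSb : S (b i) = 0 := hker _ fun n => by
      rw [← hbe]
      exact b.orthonormal.2 fun h => hrange ⟨n, h⟩
    simp [hSb]
  have hdiag : ∀ n, (inner ℂ (ψ n) (S (ψ n))).re = c n := fun n => by
    rw [heig, inner_smul_right, inner_self_eq_norm_sq_to_K, hψ.1]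
    simp
  rw [posTrace_eq_tsum hS b, ← he.tsum_eq hsupp]
  simp_rw [hbe, hdiag]

end Trace

section FunctionalCalculus

variable {H : Type*} [NormedAddCommGroup H] [InnerProductSpace ℂ H]
  {M : H →L[ℂ] H} {v : H} {c : ℝ}

theorem mem_spectrum_of_apply_eq_smul (hv : M v = (c : ℂ) • v) (hv0 : v ≠ 0) :
    c ∈ spectrum ℝ M := by
  rw [spectrum.mem_iff]
  intro hunit
  obtain ⟨R, hR⟩ := hunit.exists_left_inv
  have hker : (algebraMap ℝ (H →L[ℂ] H) c - M) v = 0 := by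
    simp [Algebra.algebraMap_eq_smul_one, hv]
  apply hv0
  calc v = (R * (algebraMap ℝ (H →L[ℂ] H) c - M)) v := by rw [hR, one_apply_eq_self]
    _ = 0 := by rw [mul_apply_eq_comp, hker, map_zero]

variable [CompleteSpace H]

theorem cfcHom_apply_of_apply_eq_smul (hM : IsSelfAdjoint M) (hv : M v = (c : ℂ) • v)
    (hc : c ∈ spectrum ℝ M) (g : C(spectrum ℝ M, ℝ)) :
    cfcHom hM g v = (g ⟨c, hc⟩ : ℂ) • v := by
  have hid : cfcHom hM (.restrict (spectrum ℝ M) (.id ℝ)) v = (c : ℂ) • v := by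
    rw [cfcHom_id, hv]
  induction g using ContinuousMap.induction_on_of_compact with
  | const r =>
    have hconst : ContinuousMap.const (spectrum ℝ M) r = algebraMap ℝ _ r := rfl
    simp [hconst, Algebra.algebraMap_eq_smul_one]
  | id => exact hid
  | star_id => exact hid
  | add f g hf hg => simp [hf, hg, add_smul]
  | mul f g hf hg =>
    rw [map_mul, mul_apply_eq_comp, hg, map_smul, hf, ContinuousMap.mul_apply, Complex.ofReal_mul,
      mul_comm, mul_smul]
  | frequently g hg =>
    have hcont : Continuous fun g : C(spectrum ℝ M, ℝ) => cfcHom hM g v :=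
      (ContinuousLinearMap.apply ℂ H v).continuous.comp (cfcHom_continuous hM)
    exact hg.mem_of_closed (isClosed_eq hcont (by fun_prop))

theorem cfc_apply_of_apply_eq_smul (hM : IsSelfAdjoint M) (hv : M v = (c : ℂ) • v) {g : ℝ → ℝ}
    (hg : ContinuousOn g (spectrum ℝ M)) : cfc g M v = (g c : ℂ) • v := by
  rcases eq_or_ne v 0 with rfl | hv0
  · simp
  · rw [cfc_apply g M]
    exact cfcHom_apply_of_apply_eq_smul hM hv (mem_spectrum_of_apply_eq_smul hv hv0) _

theorem rpow_apply_of_apply_eq_smul (hM : 0 ≤ M) {r : ℝ} (hr : 0 ≤ r)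
    (hv : M v = (c : ℂ) • v) : (M ^ r) v = ((c ^ r : ℝ) : ℂ) • v := by
  rw [CFC.rpow_eq_cfc_real hM]
  exact cfc_apply_of_apply_eq_smul (IsSelfAdjoint.of_nonneg hM) hv
    (Real.continuous_rpow_const hr).continuousOn

end FunctionalCalculus

section Schatten

variable {H ι : Type*} [NormedAddCommGroup H] [InnerProductSpace ℂ H] [CompleteSpace H]
  {T U : H →L[ℂ] H} {μ : ι → ℝ} {ψ : ι → H}

theorem schattenTrace_eq_tsum_rpow_eigenvalues {p : ℝ} (hp : 0 < p) (hψ : Orthonormal ℂ ψ)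
    {c : ι → ℝ} (heig : ∀ n, (T† * T) (ψ n) = (c n : ℂ) • ψ n)
    (hker : ∀ x, (∀ n, inner ℂ (ψ n) x = 0) → T x = 0) :
    schattenTrace p T = ∑' n, ENNReal.ofReal (c n ^ (p / 2)) := by
  have hpos : 0 ≤ T† * T := star_mul_self_nonneg T
  have hp2 : 0 < p / 2 := half_pos hp
  refine posTrace_eq_tsum_eigenvalues CFC.rpow_nonneg hψ
    (fun n => rpow_apply_of_apply_eq_smul hpos hp2.le (heig n)) fun x hx => ?_
  have hzero : (T† * T) x = ((0 : ℝ) : ℂ) • x := by simp [hker x hx]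
  rw [rpow_apply_of_apply_eq_smul hpos hp2.le hzero, Real.zero_rpow hp2.ne']
  simp

namespace IsSingularSystem

theorem adjoint_mul_self_apply (h : IsSingularSystem T U μ ψ) (n : ι) :
    (T† * T) (ψ n) = ((μ n ^ 2 : ℝ) : ℂ) • ψ n := by
  have hsq : modulus T * modulus T = T† * T :=
    CFC.sqrt_mul_sqrt_self _ (star_mul_self_nonneg T)
  rw [← hsq, mul_apply_eq_comp, h.eigen, map_smul, h.eigen, smul_smul, sq, Complex.ofReal_mul]

theorem apply_eq_zero (h : IsSingularSystem T U μ ψ) {x : H}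
    (hx : ∀ n, inner ℂ (ψ n) x = 0) : T x = 0 :=
  (h.expansion x).unique (by simp only [hx, mul_zero, zero_smul, hasSum_zero])

theorem schattenTrace_eq (h : IsSingularSystem T U μ ψ) {p : ℝ} (hp : 0 < p) :
    schattenTrace p T = ∑' n, ENNReal.ofReal ((μ n ^ 2) ^ (p / 2)) :=
  schattenTrace_eq_tsum_rpow_eigenvalues hp h.orthonormal h.adjoint_mul_self_apply
    fun _ => h.apply_eq_zero

end IsSingularSystem

variable {p : ℝ} {a : ι → ℝ}

theorem summable_of_tsum_ofReal_eq_schattenTrace (ha : ∀ n, 0 ≤ a n)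
    (htr : ∑' n, ENNReal.ofReal (a n) = schattenTrace p T) (hT : T ∈ schattenClass p H) :
    Summable a := by
  have hfin : ∑' n, ENNReal.ofReal (a n) ≠ ⊤ := htr ▸ ne_of_lt hT
  simpa only [ENNReal.toReal_ofReal (ha _)] using ENNReal.summable_toReal hfin

theorem tsum_rpow_eq_schattenNorm (ha : ∀ n, 0 ≤ a n)
    (htr : ∑' n, ENNReal.ofReal (a n) = schattenTrace p T) :
    (∑' n, a n) ^ (1 / p) = schattenNorm p T := by
  rw [schattenNorm, ← htr, ENNReal.tsum_toReal_eq fun _ => ENNReal.ofReal_ne_top]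
  simp only [ENNReal.toReal_ofReal (ha _)]

end Schatten

section Embedding

variable {B H : Type*} [NormedAddCommGroup B] [NormedSpace ℂ B]
  [NormedAddCommGroup H] [InnerProductSpace ℂ H] {j : DenseEmbedding B H} {A : B →L[ℂ] B}
  {S T : H →L[ℂ] H} {u : B} {f : B →L[ℂ] ℂ}

theorem IsExtension.unique (hS : IsExtension j A S) (hT : IsExtension j A T) : S = T :=
  DFunLike.coe_injective <| j.dense.equalizer S.continuous T.continuous <|
    funext fun u => (hS u).trans (hT u).symm

theorem toCLM_restrictToB_apply (u : (restrictToB j S).domain) :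
    j.toCLM (restrictToB j S u) = S (j.toCLM u) :=
  congrArg Subtype.val
    ((LinearEquiv.ofInjective (j.toCLM : B →ₗ[ℂ] H) j.injective).apply_symm_apply
      ⟨S (j.toCLM u), u.2⟩)

theorem IsSteadmanMap.apply_self (hf : IsSteadmanMap j u f) : f u = ((‖u‖ ^ 2 : ℝ) : ℂ) := by
  rw [hf.on_span u (Submodule.mem_span_singleton_self u), inner_self_eq_norm_sq_to_K]
  rcases eq_or_ne u 0 with rfl | hu
  · simp
  · have hju : (‖j.toCLM u‖ : ℂ) ≠ 0 := by
      simpa using (map_ne_zero_iff j.toCLM j.injective).mpr hu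
    push_cast
    exact div_mul_cancel₀ _ (pow_ne_zero 2 hju)

variable [CompleteSpace H]

theorem IsExtension.mem_schattenClass {p : ℝ} (hT : IsExtension j A T)
    (hA : A ∈ banachSchattenClass j p) : T ∈ schattenClass p H := by
  obtain ⟨S, hS, hAS⟩ := hA
  rwa [hT.unique hAS]

theorem starPairing_eq_mul_norm_sq (hf : IsSteadmanMap j u f)
    (hu : A u ∈ (banachAdjoint j T).domain) {c : ℂ}
    (heig : (T†) (j.toCLM (A u)) = j.toCLM (c • u)) :
    starPairing j A T u hu f = c * ((‖u‖ ^ 2 : ℝ) : ℂ) := by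
  have happly : banachAdjoint j T ⟨A u, hu⟩ = c • u :=
    j.injective ((toCLM_restrictToB_apply _).trans heig)
  rw [starPairing, happly, map_smul, hf.apply_self, smul_eq_mul]

theorem IsSingularSystem.adjoint_toCLM_apply {ι : Type*} {U : H →L[ℂ] H} {μ : ι → ℝ} {ψ : ι → B}
    (hψ : IsSingularSystem T U μ (fun n => j.toCLM (ψ n))) (hT : IsExtension j A T) (n : ι)
    (t : ℂ) :
    (T†) (j.toCLM (A (t • ψ n))) = j.toCLM (((μ n ^ 2 : ℝ) : ℂ) • t • ψ n) := by
  have heig : (T†) (T (j.toCLM (ψ n))) = ((μ n ^ 2 : ℝ) : ℂ) • j.toCLM (ψ n) :=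
    hψ.adjoint_mul_self_apply n
  rw [← hT]
  simp only [map_smul, heig, smul_comm t]

end Embedding

end SchattenBanach

theorem theorem6p2_general {B H₂ : Type*} [NormedAddCommGroup B] [NormedSpace ℂ B]
    [NormedAddCommGroup H₂] [InnerProductSpace ℂ H₂] [CompleteSpace H₂]
    (j : SchattenBanach.DenseEmbedding B H₂) (p : ℝ) (hp : 0 < p) (A : B →L[ℂ] B)
    (Abar : H₂ →L[ℂ] H₂) (hAbar : SchattenBanach.IsExtension j A Abar)
    {ι : Type*} (U : H₂ →L[ℂ] H₂) (μ : ι → ℝ) (ψ : ι → B)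
    (hψ : SchattenBanach.IsSingularSystem Abar U μ (fun n => j.toCLM (ψ n)))
    (φ : ι → B) (hφ : ∀ n, φ n = ((‖ψ n‖⁻¹ : ℝ) : ℂ) • ψ n)
    (f : ι → B →L[ℂ] ℂ) (hf : ∀ n, SchattenBanach.IsSteadmanMap j (φ n) (f n)) :
    ∃ hdom : ∀ n, A (φ n) ∈ (SchattenBanach.banachAdjoint j Abar).domain,
      (∀ n, 0 ≤ (SchattenBanach.starPairing j A Abar (φ n) (hdom n) (f n)).re ∧
        (SchattenBanach.starPairing j A Abar (φ n) (hdom n) (f n)).im = 0) ∧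
      ∑' n, ENNReal.ofReal
          ((SchattenBanach.starPairing j A Abar (φ n) (hdom n) (f n)).re ^ (p / 2)) =
        SchattenBanach.schattenTrace p Abar := by
  have heig : ∀ n, (ContinuousLinearMap.adjoint Abar) (j.toCLM (A (φ n))) =
      j.toCLM (((μ n ^ 2 : ℝ) : ℂ) • φ n) := fun n => by
    rw [hφ]
    exact hψ.adjoint_toCLM_apply hAbar n _
  have hdom : ∀ n, A (φ n) ∈ (SchattenBanach.banachAdjoint j Abar).domain := fun n =>
    ⟨_, (heig n).symm⟩
  have hnorm : ∀ n, ‖φ n‖ = 1 := fun n => by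
    have hψn : ψ n ≠ 0 := fun h => hψ.orthonormal.ne_zero n (by simp [h])
    rw [hφ]
    simp [norm_smul, hψn]
  have hpair : ∀ n, SchattenBanach.starPairing j A Abar (φ n) (hdom n) (f n) =
      ((μ n ^ 2 : ℝ) : ℂ) := fun n => by
    simp [SchattenBanach.starPairing_eq_mul_norm_sq (hf n) (hdom n) (heig n), hnorm]
  refine ⟨hdom, fun n => ?_, ?_⟩
  · rw [hpair, Complex.ofReal_re, Complex.ofReal_im]
    exact ⟨sq_nonneg _, rfl⟩
  · simp only [hpair, Complex.ofReal_re, hψ.schattenTrace_eq hp]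

theorem theorem6p2 {B H₂ : Type*}
    [NormedAddCommGroup B] [NormedSpace ℂ B] [CompleteSpace B] [TopologicalSpace.SeparableSpace B]
    [NormedAddCommGroup H₂] [InnerProductSpace ℂ H₂] [CompleteSpace H₂]
    (j : SchattenBanach.DenseEmbedding B H₂) (p : ℝ) (hp : 0 < p)
    (A : B →L[ℂ] B) (hA : A ∈ SchattenBanach.banachSchattenClass j p)
    (Abar : H₂ →L[ℂ] H₂) (hAbar : SchattenBanach.IsExtension j A Abar)
    {ι : Type*} (U : H₂ →L[ℂ] H₂) (μ : ι → ℝ) (ψ : ι → B)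
    (hψ : SchattenBanach.IsSingularSystem Abar U μ (fun n => j.toCLM (ψ n)))
    (φ : ι → B) (hφ : ∀ n, φ n = ((‖ψ n‖⁻¹ : ℝ) : ℂ) • ψ n)
    (f : ι → B →L[ℂ] ℂ) (hf : ∀ n, SchattenBanach.IsSteadmanMap j (φ n) (f n)) :
    ∃ hdom : ∀ n, A (φ n) ∈ (SchattenBanach.banachAdjoint j Abar).domain,
      (∀ n, 0 ≤ (SchattenBanach.starPairing j A Abar (φ n) (hdom n) (f n)).re ∧
        (SchattenBanach.starPairing j A Abar (φ n) (hdom n) (f n)).im = 0) ∧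
      Summable (fun n =>
        (SchattenBanach.starPairing j A Abar (φ n) (hdom n) (f n)).re ^ (p / 2)) ∧
      SchattenBanach.banachSchattenNorm j p A Abar φ hdom f =
        SchattenBanach.schattenNorm p Abar := by
  obtain ⟨hdom, hreal, htr⟩ := theorem6p2_general j p hp A Abar hAbar U μ ψ hψ φ hφ f hf
  have hnn := fun n => Real.rpow_nonneg (hreal n).1 (p / 2)
  exact ⟨hdom, hreal, SchattenBanach.summable_of_tsum_ofReal_eq_schattenTrace hnn htr
    (hAbar.mem_schattenClass hA), SchattenBanach.tsum_rpow_eq_schattenNorm hnn htr⟩
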